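/- For a group $\Gamma$ and $n\ge 0$ let $H^n(\Gamma,-)=\operatorname{Ext}^n_{\mathbb Z\Gamma}(\mathbb Z,-)$, regarded as a functor from $\mathbb Z\Gamma$-modules to $\mathbb Z$-modules. This functor is called finitary if it commutes with all filtered colimits of coefficient modules, and $\Gamma$ is said to have cohomology almost everywhere finitary if $H^n(\Gamma,-)$ is finitary for all sufficiently large $n$. The group $\Gamma$ is of type $\mathrm{FP}_\infty$ if the trivial $\mathbb Z\Gamma$-module $\mathbb Z$ has a resolution by finitely generated projective $\mathbb Z\Gamma$-modules. **Proposition.** Let $G$ be a group of type $\mathrm{FP}_\infty$, let $H$ be a subgroup of $G$ that is not finitely generated, and let $Q$ be a non-trivial finite group. Then $G\times Q$ has cohomology almost everywhere finitary, but there is no $n\ge 0$ for which $H^n(H\times Q,-)$ is finitary; in particular, $H\times Q$ does not have cohomology almost everywhere finitary. -/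

import Mathlib

open CategoryTheory

universe u

/-- The group `G` is of type `FP_∞` over the commutative ring `k`: the trivial `kG`-module `k` has
a projective resolution `⋯ ⟶ P₁ ⟶ P₀ ⟶ k ⟶ 0` all of whose terms are finitely generated
`kG`-modules. The `kG`-modules are Mathlib's `k`-linear representations of `G`. -/
def IsFPInftyOver (k G : Type u) [CommRing k] [Group G] : Prop :=
  ∃ P : ProjectiveResolution (Rep.trivial k G k),
    ∀ i : ℕ, Module.Finite (MonoidAlgebra k G) (P.complex.X i).ρ.asModule

/-- The functor `Hⁿ(G, -)` from `kG`-modules to `k`-modules is finitary: it commutes with all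
(small) filtered colimits of coefficient modules. -/
def CohomologyFinitaryOver (k G : Type u) [CommRing k] [Group G] (n : ℕ) : Prop :=
  Limits.PreservesFilteredColimits (groupCohomology.functor.{u} k G n)

/-- The group `G` is of type `FP_∞` (over `ℤ`, lifted to the universe of `G`). -/
def IsFPInfty (G : Type u) [Group G] : Prop :=
  IsFPInftyOver (ULift.{u} ℤ) G

/-- `Hⁿ(G, -)` is finitary as a functor on `ℤG`-modules (`ℤ` is lifted to the universe of `G`). -/
def CohomologyFinitary (G : Type u) [Group G] (n : ℕ) : Prop :=
  CohomologyFinitaryOver (ULift.{u} ℤ) G n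

/-- `G` has cohomology almost everywhere finitary: `Hⁿ(G, -)` is finitary for all sufficiently
large `n`. -/
def CohomologyAlmostEverywhereFinitary (G : Type u) [Group G] : Prop :=
  ∃ n₀ : ℕ, ∀ n : ℕ, n₀ ≤ n → CohomologyFinitary G n

/-! Positive half. If `P` resolves the trivial module by finitely generated projectives, each
Hom(P_i, -) commutes with filtered colimits, hence so does the cohomology of Hom(P, -), and every
Hⁿ(G, -) is finitary. This passes from a subgroup S of finite index to the whole group by dimension
shifting along 0 → M → Coind Res M → M' → 0: Shapiro's lemma turns the middle term into cohomology
of S, and M ↦ M' preserves colimits, so a diagram chase by induction on the degree applies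
(`cohomologyFinitaryOver_of_finiteIndex`). The factor G has finite index in G × Q.

Negative half (`not_cohomologyFinitaryOver_prod`). As |Q| is not a unit, there are a Q-module A and
a class x ≠ 0 in Hⁿ(Q, A). Inflated to H × Q, A is the filtered colimit of k[H/K] ⊗ A over finitely
generated K ≤ H, all of infinite index. If Hⁿ were finitary, the inflation of x would come from a
class y with coefficients in some k[H/K] ⊗ A. Restricted to Q, y has one component in Hⁿ(Q, A) per
coset. Since H centralizes Q, it acts trivially on restricted classes
(`groupCohomology.map_centralizerAct`), while permuting the cosets transitively: all components are
equal. Since Q is finite, a cocycle on Q meets only finitely many cosets, so some component is zero.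
Hence all are zero, and so is their sum x, a contradiction. -/

/-! ### Filtered colimits, tested on elements -/

section FilteredColimits

open Limits

variable {k : Type u} [CommRing k] {C : Type*} [Category* C]

/-- Every element of the value of `F` at a filtered colimit comes from a finite stage. -/
def LiftsFilteredColimits (F : C ⥤ ModuleCat.{u} k) : Prop :=
  ∀ (J : Type u) [SmallCategory J] [IsFiltered J] (D : J ⥤ C) (c : Cocone D),
    IsColimit c → ∀ x : F.obj c.pt, ∃ (j : J) (y : F.obj (D.obj j)),
      F.map (Y := c.pt) (c.ι.app j) y = x

/-- An element that vanishes in the value of `F` at a filtered colimit vanishes at a finite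
stage. -/
def DetectsFilteredColimits (F : C ⥤ ModuleCat.{u} k) : Prop :=
  ∀ (J : Type u) [SmallCategory J] [IsFiltered J] (D : J ⥤ C) (c : Cocone D),
    IsColimit c → ∀ (j : J) (y : F.obj (D.obj j)), F.map (Y := c.pt) (c.ι.app j) y = 0 →
      ∃ (j' : J) (f : j ⟶ j'), F.map (D.map f) y = 0

/-- The forgetful functor to types reflects filtered colimits, and by linearity injectivity in the
colimit only has to be tested against zero. -/
theorem preservesFilteredColimits_of_lifts_of_detects {F : C ⥤ ModuleCat.{u} k}
    (hl : LiftsFilteredColimits F) (hd : DetectsFilteredColimits F) :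
    PreservesFilteredColimits F where
  preserves_filtered_colimits J _ _ :=
    { preservesColimit {D} :=
      { preserves {c} hc := by
          refine ⟨isColimitOfReflects (forget (ModuleCat.{u} k)) ?_⟩
          refine Types.FilteredColimit.isColimitOf' _ _ (fun x ↦ ?_) (fun j x y hxy ↦ ?_)
          · obtain ⟨j, y, hy⟩ := hl J D c hc x
            exact ⟨j, y, hy.symm⟩
          · have h0 : F.map (c.ι.app j) (show F.obj (D.obj j) from x - y) = 0 := by
              rw [map_sub]
              exact sub_eq_zero.2 hxy
            obtain ⟨j', f, hf⟩ := hd J D c hc j _ h0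
            rw [map_sub] at hf
            exact ⟨j', f, sub_eq_zero.1 hf⟩ } }

theorem lifts_of_preservesFilteredColimits {F : C ⥤ ModuleCat.{u} k}
    [PreservesFilteredColimits F] : LiftsFilteredColimits F := by
  intro J _ _ D c hc x
  obtain ⟨j, y, hy⟩ := Types.jointly_surjective _
    (isColimitOfPreserves (F ⋙ forget (ModuleCat.{u} k)) hc) x
  exact ⟨j, y, hy⟩

theorem detects_of_preservesFilteredColimits {F : C ⥤ ModuleCat.{u} k}
    [PreservesFilteredColimits F] : DetectsFilteredColimits F := by
  intro J _ _ D c hc j y hy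
  obtain ⟨j', f, hf⟩ := (Types.FilteredColimit.isColimit_eq_iff' 
    (isColimitOfPreserves (F ⋙ forget (ModuleCat.{u} k)) hc) y 
      (show F.obj (D.obj j) from 0)).1 (hy.trans (map_zero (F.map (c.ι.app j)).hom).symm)
  exact ⟨j', f, hf.trans (map_zero (F.map (D.map f)).hom)⟩

theorem LiftsFilteredColimits.of_iso {F F' : C ⥤ ModuleCat.{u} k} (e : F ≅ F')
    (h : LiftsFilteredColimits F) : LiftsFilteredColimits F' := by
  intro J _ _ D c hc x
  obtain ⟨j, y, hy⟩ := h J D c hc (e.inv.app _ x)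
  refine ⟨j, e.hom.app _ y, ?_⟩
  rw [← ConcreteCategory.comp_apply, ← e.hom.naturality, ConcreteCategory.comp_apply, hy]
  simp

theorem DetectsFilteredColimits.of_iso {F F' : C ⥤ ModuleCat.{u} k} (e : F ≅ F')
    (h : DetectsFilteredColimits F) : DetectsFilteredColimits F' := by
  intro J _ _ D c hc j y hy
  obtain ⟨j', f, hf⟩ := h J D c hc j (e.inv.app _ y) (by
    rw [← ConcreteCategory.comp_apply, ← e.inv.naturality, ConcreteCategory.comp_apply, hy,
      map_zero])
  refine ⟨j', f, ?_⟩
  rw [← ConcreteCategory.comp_apply, ← e.inv.naturality, ConcreteCategory.comp_apply] at hf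
  simpa using congr(e.hom.app _ $hf)

variable {B : Type*} [Category* B]

theorem LiftsFilteredColimits.comp (K : B ⥤ C) [PreservesFilteredColimitsOfSize.{u, u} K]
    {F : C ⥤ ModuleCat.{u} k} (h : LiftsFilteredColimits F) :
    LiftsFilteredColimits (K ⋙ F) := fun J _ _ D c hc x ↦
  h J (D ⋙ K) (K.mapCocone c) (isColimitOfPreserves K hc) x

theorem DetectsFilteredColimits.comp (K : B ⥤ C) [PreservesFilteredColimitsOfSize.{u, u} K]
    {F : C ⥤ ModuleCat.{u} k} (h : DetectsFilteredColimits F) :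
    DetectsFilteredColimits (K ⋙ F) := fun J _ _ D c hc x ↦
  h J (D ⋙ K) (K.mapCocone c) (isColimitOfPreserves K hc) x

end FilteredColimits

/-! ### Homology and filtered colimits -/

section Homology

open Limits

variable {k : Type u} [CommRing k] {C : Type*} [Category* C]

namespace ModuleCat

variable (S : ShortComplex (ModuleCat.{u} k))

theorem exists_iCycles_eq (x : S.X₂) (hx : S.g x = 0) : ∃ z : S.cycles, S.iCycles z = x :=
  (ShortComplex.moduleCat_exact_iff _).1
    (ShortComplex.exact_of_f_is_kernel (.mk _ _ S.iCycles_g) S.cyclesIsKernel) x hx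

theorem exists_toCycles_eq (z : S.cycles) (hz : S.homologyπ z = 0) :
    ∃ x : S.X₁, S.toCycles x = z :=
  (ShortComplex.moduleCat_exact_iff _).1
    (ShortComplex.exact_of_g_is_cokernel (.mk _ _ S.toCycles_comp_homologyπ)
      S.homologyIsCokernel) z hz

theorem exists_homologyπ_eq (x : S.homology) : ∃ z : S.cycles, S.homologyπ z = x :=
  (ModuleCat.epi_iff_surjective S.homologyπ).1 inferInstance x

theorem iCycles_injective : Function.Injective S.iCycles :=
  (ModuleCat.mono_iff_injective S.iCycles).1 inferInstance

end ModuleCat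

open ModuleCat ShortComplex

/-- A cycle over the colimit lifts to some stage as a mere element; its image under `g` dies in the
colimit, hence at a later stage, where the lift becomes a cycle. -/
theorem LiftsFilteredColimits.homology {T : C ⥤ ShortComplex (ModuleCat.{u} k)}
    (h₂ : LiftsFilteredColimits (T ⋙ π₂)) (h₃ : DetectsFilteredColimits (T ⋙ π₃)) :
    LiftsFilteredColimits (T ⋙ homologyFunctor (ModuleCat.{u} k)) := by
  intro J _ _ D c hc x
  -- The legs are retyped with target `c.pt` instead of a value of the constant functor, so that
  -- rewriting applies.
  obtain ⟨ι, hι, w⟩ : ∃ ι : ∀ j, D.obj j ⟶ c.pt, (∀ j, c.ι.app j = ι j) ∧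
      ∀ {i j : J} (f : i ⟶ j), D.map f ≫ ι j = ι i := ⟨c.ι.app, fun _ ↦ rfl, c.w⟩
  obtain ⟨z, rfl⟩ := exists_homologyπ_eq _ x
  obtain ⟨j, y, hy⟩ : ∃ (j : J) (y : (T.obj (D.obj j)).X₂),
      (T.map (ι j)).τ₂ y = (T.obj c.pt).iCycles z := by
    obtain ⟨j, y, hy⟩ := h₂ J D c hc ((T.obj c.pt).iCycles z)
    exact ⟨j, y, hι j ▸ hy⟩
  obtain ⟨j', f, hf⟩ := h₃ J D c hc j ((T.obj (D.obj j)).g y) (by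
    rw [hι]
    change (T.map (ι j)).τ₃ ((T.obj (D.obj j)).g y) = 0
    rw [← ConcreteCategory.comp_apply, ← (T.map (ι j)).comm₂₃, ConcreteCategory.comp_apply,
      hy, ← ConcreteCategory.comp_apply, ShortComplex.iCycles_g]
    rfl)
  change (T.map (D.map f)).τ₃ ((T.obj (D.obj j)).g y) = 0 at hf
  rw [← ConcreteCategory.comp_apply, ← (T.map (D.map f)).comm₂₃,
    ConcreteCategory.comp_apply] at hf
  obtain ⟨v, hv⟩ := exists_iCycles_eq _ _ hf
  refine ⟨j', (T.obj (D.obj j')).homologyπ v, ?_⟩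
  rw [hι]
  change ShortComplex.homologyMap (T.map (ι j')) _ = _
  rw [← ConcreteCategory.comp_apply, ShortComplex.homologyπ_naturality,
    ConcreteCategory.comp_apply]
  congr 1
  apply iCycles_injective
  rw [← ConcreteCategory.comp_apply, ShortComplex.cyclesMap_i, ConcreteCategory.comp_apply, hv,
    ← hy, ← ConcreteCategory.comp_apply, ← comp_τ₂, ← T.map_comp, w]

/-- An element bounding the cycle over the colimit lifts to some stage; the cycle minus the boundary
of that lift dies in the colimit, hence at a later stage. -/
theorem DetectsFilteredColimits.homology {T : C ⥤ ShortComplex (ModuleCat.{u} k)}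
    (h₁ : LiftsFilteredColimits (T ⋙ π₁)) (h₂ : DetectsFilteredColimits (T ⋙ π₂)) :
    DetectsFilteredColimits (T ⋙ homologyFunctor (ModuleCat.{u} k)) := by
  intro J _ _ D c hc j y hy
  obtain ⟨ι, hι, w⟩ : ∃ ι : ∀ j, D.obj j ⟶ c.pt, (∀ j, c.ι.app j = ι j) ∧
      ∀ {i j : J} (f : i ⟶ j), D.map f ≫ ι j = ι i := ⟨c.ι.app, fun _ ↦ rfl, c.w⟩
  rw [hι] at hy
  obtain ⟨z, rfl⟩ := exists_homologyπ_eq _ y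
  change ShortComplex.homologyMap (T.map (ι j)) _ = _ at hy
  rw [← ConcreteCategory.comp_apply, ShortComplex.homologyπ_naturality,
    ConcreteCategory.comp_apply] at hy
  obtain ⟨b, hb⟩ := exists_toCycles_eq _ _ hy
  obtain ⟨i, a, ha⟩ : ∃ (i : J) (a : (T.obj (D.obj i)).X₁), (T.map (ι i)).τ₁ a = b := by
    obtain ⟨i, a, ha⟩ := h₁ J D c hc b
    exact ⟨i, a, hι i ▸ ha⟩
  let m := IsFiltered.max i j
  let p : i ⟶ m := IsFiltered.leftToMax i j
  let q : j ⟶ m := IsFiltered.rightToMax i j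
  let v : (T.obj (D.obj m)).X₂ := (T.map (D.map q)).τ₂ ((T.obj (D.obj j)).iCycles z) -
    (T.obj (D.obj m)).f ((T.map (D.map p)).τ₁ a)
  obtain ⟨m', r, hr⟩ := h₂ J D c hc m v (by
    rw [hι]
    change (T.map (ι m)).τ₂ v = 0
    rw [map_sub, sub_eq_zero, ← ConcreteCategory.comp_apply, ← comp_τ₂, ← T.map_comp, w,
      ← ConcreteCategory.comp_apply (T.obj (D.obj m)).f, ← (T.map (ι m)).comm₁₂,
      ConcreteCategory.comp_apply, ← ConcreteCategory.comp_apply (T.map (D.map p)).τ₁,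
      ← comp_τ₁, ← T.map_comp, w, ha, ← ShortComplex.toCycles_i,
      ConcreteCategory.comp_apply, hb, ← ConcreteCategory.comp_apply,
      ← ConcreteCategory.comp_apply, ShortComplex.cyclesMap_i])
  change (T.map (D.map r)).τ₂ v = 0 at hr
  refine ⟨m', q ≫ r, ?_⟩
  change ShortComplex.homologyMap (T.map (D.map (q ≫ r))) _ = _
  rw [← ConcreteCategory.comp_apply, ShortComplex.homologyπ_naturality,
    ConcreteCategory.comp_apply]
  have key : ShortComplex.cyclesMap (T.map (D.map (q ≫ r))) z =
      (T.obj (D.obj m')).toCycles ((T.map (D.map (p ≫ r))).τ₁ a) := by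
    apply iCycles_injective
    rw [map_sub, sub_eq_zero, ← ConcreteCategory.comp_apply, ← comp_τ₂, ← T.map_comp,
      ← D.map_comp, ← ConcreteCategory.comp_apply (T.obj (D.obj m)).f,
      ← (T.map (D.map r)).comm₁₂, ConcreteCategory.comp_apply,
      ← ConcreteCategory.comp_apply (T.map (D.map p)).τ₁,
      ← comp_τ₁, ← T.map_comp, ← D.map_comp] at hr
    rw [← ConcreteCategory.comp_apply, ShortComplex.cyclesMap_i, ConcreteCategory.comp_apply, hr,
      ← ConcreteCategory.comp_apply (T.obj (D.obj m')).toCycles, ShortComplex.toCycles_i]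
  rw [key, ← ConcreteCategory.comp_apply, ShortComplex.toCycles_comp_homologyπ]
  rfl

variable {K : C ⥤ CochainComplex (ModuleCat.{u} k) ℕ}

theorem LiftsFilteredColimits.cochainComplex_homology
    (hl : ∀ i, LiftsFilteredColimits (K ⋙ HomologicalComplex.eval _ _ i))
    (hd : ∀ i, DetectsFilteredColimits (K ⋙ HomologicalComplex.eval _ _ i)) (n : ℕ) :
    LiftsFilteredColimits (K ⋙ HomologicalComplex.homologyFunctor _ _ n) :=
  LiftsFilteredColimits.homology
    (T := K ⋙ HomologicalComplex.shortComplexFunctor _ _ n) (hl n) (hd _)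

theorem DetectsFilteredColimits.cochainComplex_homology
    (hl : ∀ i, LiftsFilteredColimits (K ⋙ HomologicalComplex.eval _ _ i))
    (hd : ∀ i, DetectsFilteredColimits (K ⋙ HomologicalComplex.eval _ _ i)) (n : ℕ) :
    DetectsFilteredColimits (K ⋙ HomologicalComplex.homologyFunctor _ _ n) :=
  DetectsFilteredColimits.homology
    (T := K ⋙ HomologicalComplex.shortComplexFunctor _ _ n) (hl _) (hd n)

end Homology

/-! ### Cohomology from a projective resolution; groups of type FP_∞ -/

section HomComplex

open Limits

variable {k G : Type u} [CommRing k] [Group G]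

namespace Rep

/-- The functor `A ↦ Hom(P, A)` for a chain complex `P` of representations. -/
noncomputable def homComplexFunctor (P : ChainComplex (Rep.{u} k G) ℕ) :
    Rep.{u} k G ⥤ CochainComplex (ModuleCat.{u} k) ℕ where
  obj A := P.linearYonedaObj k A
  map {A _} φ :=
    { f i := ModuleCat.ofHom (Linear.rightComp k (P.X i) φ)
      comm' i j _ := ModuleCat.hom_ext <| LinearMap.ext fun (f : P.X i ⟶ A) ↦
        (Category.assoc (P.d j i) f φ).symm }
  map_id A := HomologicalComplex.hom_ext _ _ fun i ↦ ModuleCat.hom_ext <|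
    LinearMap.ext fun (f : P.X i ⟶ A) ↦ Category.comp_id f
  map_comp φ ψ := HomologicalComplex.hom_ext _ _ fun i ↦ ModuleCat.hom_ext <|
    LinearMap.ext fun (f : P.X i ⟶ _) ↦ (Category.assoc f φ ψ).symm

/-- The chain complex in the opposite category underlying `Hom(P, A)`. -/
noncomputable abbrev homOpFunctor (A : Rep.{u} k G) :
    ChainComplex (Rep.{u} k G) ℕ ⥤ ChainComplex (ModuleCat.{u} k)ᵒᵖ ℕ :=
  ((linearYoneda k (Rep.{u} k G)).obj A).rightOp.mapHomologicalComplex _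

/-- Precomposition with a chain map `P ⟶ P'`, as a natural transformation
`Hom(P', -) ⟶ Hom(P, -)`. -/
noncomputable def homComplexPrecomp {P P' : ChainComplex (Rep.{u} k G) ℕ} (a : P ⟶ P') :
    homComplexFunctor P' ⟶ homComplexFunctor P where
  app A := (HomologicalComplex.unopFunctor _ _).map ((homOpFunctor A).map a).op
  naturality _ _ φ := HomologicalComplex.hom_ext _ _ fun i ↦ ModuleCat.hom_ext <|
    LinearMap.ext fun (f : P'.X i ⟶ _) ↦ (Category.assoc (a.f i) f φ).symm

theorem isIso_homologyMap_homComplexPrecomp {P P' : ChainComplex (Rep.{u} k G) ℕ}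
    (e : HomotopyEquiv P P') (A : Rep.{u} k G) (n : ℕ) :
    IsIso (HomologicalComplex.homologyMap ((homComplexPrecomp e.hom).app A) n) := by
  have : QuasiIso ((homOpFunctor A).map e.hom) :=
    (((linearYoneda k (Rep.{u} k G)).obj A).rightOp.mapHomotopyEquiv e).quasiIso_hom
  have : QuasiIso ((homComplexPrecomp e.hom).app A) := by
    change QuasiIso ((HomologicalComplex.unopFunctor _ _).map ((homOpFunctor A).map e.hom).op)
    infer_instance
  infer_instance

/-- The functor `A ↦ Hⁿ(Hom(P, A))`. -/
noncomputable abbrev homComplexHomology (P : ChainComplex (Rep.{u} k G) ℕ) (n : ℕ) :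
    Rep.{u} k G ⥤ ModuleCat.{u} k :=
  homComplexFunctor P ⋙ HomologicalComplex.homologyFunctor _ _ n

/-- Homotopy equivalent complexes `P` have naturally isomorphic `Hⁿ(Hom(P, -))`. -/
noncomputable def homComplexHomologyIso {P P' : ChainComplex (Rep.{u} k G) ℕ}
    (e : HomotopyEquiv P P') (n : ℕ) : homComplexHomology P' n ≅ homComplexHomology P n :=
  have (A : Rep.{u} k G) : IsIso ((Functor.whiskerRight (homComplexPrecomp e.hom)
      (HomologicalComplex.homologyFunctor _ _ n)).app A) :=
    isIso_homologyMap_homComplexPrecomp e A n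
  have := NatIso.isIso_of_isIso_app (Functor.whiskerRight (homComplexPrecomp e.hom)
      (HomologicalComplex.homologyFunctor _ _ n))
  asIso (Functor.whiskerRight (homComplexPrecomp e.hom)
      (HomologicalComplex.homologyFunctor _ _ n))

variable (k G) in
/-- The complex of inhomogeneous cochains is naturally `Hom(P, -)` for the bar resolution `P`. -/
noncomputable def cochainsFunctorIso :
    groupCohomology.cochainsFunctor k G ≅ homComplexFunctor (barComplex k G) :=
  NatIso.ofComponents (fun A ↦ groupCohomology.inhomogeneousCochainsIso A) fun {A B} φ ↦ by
    ext i : 1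
    refine ModuleCat.hom_ext <| LinearMap.ext fun (x : (Fin i → G) → A) ↦ ?_
    change freeLift k G B (fun a ↦ φ.hom (x a)) = freeLift k G A x ≫ φ
    refine free_ext _ _ _ _ _ fun a ↦ ?_
    simp

/-- Group cohomology is naturally the cohomology of `Hom(P, -)` for any projective resolution `P`
of the trivial representation. -/
noncomputable def groupCohomologyNatIso (P : ProjectiveResolution (Rep.trivial k G k)) (n : ℕ) :
    groupCohomology.functor k G n ≅ homComplexHomology P.complex n :=
  (show groupCohomology.functor k G n ≅ groupCohomology.cochainsFunctor k G ⋙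
      HomologicalComplex.homologyFunctor _ _ n from NatIso.ofComponents (fun _ ↦ Iso.refl _)
        fun _ ↦ (Category.comp_id _).trans (Category.id_comp _).symm) ≪≫
    Functor.isoWhiskerRight (cochainsFunctorIso k G) _ ≪≫
    homComplexHomologyIso (P.homotopyEquiv (barResolution k G)) n

/-- A representation that is finitely generated over the group ring is a quotient of a free
representation of finite rank. -/
theorem exists_epi_free_of_finite (V : Rep.{u} k G)
    [Module.Finite (MonoidAlgebra k G) V.ρ.asModule] :
    ∃ (n : ℕ) (p : free k G (ULift.{u} (Fin n)) ⟶ V), Epi p := by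
  obtain ⟨n, s, hs⟩ := Module.Finite.exists_fin (R := MonoidAlgebra k G) (M := V.ρ.asModule)
  let p : free k G (ULift.{u} (Fin n)) ⟶ V := freeLift k G V fun a ↦ V.ρ.asModuleEquiv (s a.down)
  refine ⟨n, p, (epi_iff_surjective p).2 ?_⟩
  have h : LinearMap.range (toModuleMonoidAlgebraMap p).hom = ⊤ := by
    rw [← top_le_iff, ← hs, Submodule.span_le]
    rintro _ ⟨a, rfl⟩
    refine ⟨Finsupp.single ⟨a⟩ (.single 1 1), ?_⟩
    change p.hom (Finsupp.single ⟨a⟩ (.single 1 1)) = _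
    simp [p]
    rfl
  intro v
  obtain ⟨w, hw⟩ := LinearMap.range_eq_top.1 h v
  exact ⟨w, hw⟩

theorem detects_forget₂ : DetectsFilteredColimits (forget₂ (Rep.{u} k G) (ModuleCat.{u} k)) :=
  detects_of_preservesFilteredColimits

theorem lifts_forget₂ : LiftsFilteredColimits (forget₂ (Rep.{u} k G) (ModuleCat.{u} k)) :=
  lifts_of_preservesFilteredColimits

section FilteredDiagram

variable {J : Type u} [SmallCategory J] [IsFiltered J] {D : J ⥤ Rep.{u} k G} {c : Cocone D}
  (hc : IsColimit c) {ι : Type*} [Finite ι]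

include hc

theorem exists_map_eq_zero_of_finite {j : J} (x : ι → D.obj j)
    (hx : ∀ a, (c.ι.app j).hom (x a) = 0) :
    ∃ (m : J) (g : j ⟶ m), ∀ a, (D.map g).hom (x a) = 0 := by
  classical
  have := Fintype.ofFinite ι
  suffices h : ∀ s : Finset ι, ∃ (m : J) (g : j ⟶ m), ∀ a ∈ s, (D.map g).hom (x a) = 0 by
    simpa using h Finset.univ
  intro s
  induction s using Finset.induction with
  | empty => exact ⟨j, 𝟙 j, by simp⟩
  | insert b s _ ih =>
    obtain ⟨m, g, hg⟩ := ih
    obtain ⟨m', g', hg'⟩ := detects_forget₂ J D c hc j (x b) (hx b)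
    change (D.map g').hom (x b) = 0 at hg'
    obtain ⟨l, r, r', e⟩ := IsFiltered.span g g'
    refine ⟨l, g ≫ r, fun a ha ↦ ?_⟩
    obtain rfl | ha := Finset.mem_insert.1 ha
    · rw [e, D.map_comp]
      change (D.map r').hom ((D.map g').hom (x a)) = 0
      rw [hg', map_zero]
    · rw [D.map_comp]
      change (D.map r).hom ((D.map g).hom (x a)) = 0
      rw [hg a ha, map_zero]

theorem exists_lift_of_finite (x : ι → c.pt) :
    ∃ (m : J) (y : ι → D.obj m), ∀ a, (c.ι.app m).hom (y a) = x a := by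
  classical
  have := Fintype.ofFinite ι
  choose j y hy using fun a ↦ lifts_forget₂ J D c hc (x a)
  obtain ⟨m, hm⟩ := IsFiltered.sup_objs_exists (Finset.univ.image j)
  have g (a : ι) : j a ⟶ m := (hm (Finset.mem_image_of_mem j (Finset.mem_univ a))).some
  refine ⟨m, fun a ↦ (D.map (g a)).hom (y a), fun a ↦ ?_⟩
  rw [← hy a, ← c.w (g a)]
  rfl

end FilteredDiagram

/-- A map that dies in the colimit does so on finitely many generators, hence at one stage. Finite
generation suffices here; projectivity is needed only for lifting. -/
theorem detects_homComplexFunctor_eval (P : ChainComplex (Rep.{u} k G) ℕ) (i : ℕ)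
    [Module.Finite (MonoidAlgebra k G) (P.X i).ρ.asModule] :
    DetectsFilteredColimits (homComplexFunctor P ⋙ HomologicalComplex.eval _ _ i) := by
  intro J _ _ D c hc j (f : P.X i ⟶ D.obj j) (hf : f ≫ c.ι.app j = 0)
  obtain ⟨n, p, _⟩ := exists_epi_free_of_finite (P.X i)
  obtain ⟨m, g, hg⟩ := exists_map_eq_zero_of_finite hc
    (fun a : ULift.{u} (Fin n) ↦ (p ≫ f).hom (Finsupp.single a (.single 1 1))) fun a ↦ by
      change (p ≫ f ≫ c.ι.app j).hom _ = 0
      rw [hf, comp_zero]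
      rfl
  refine ⟨m, g, ?_⟩
  change f ≫ D.map g = 0
  rw [← cancel_epi p, comp_zero]
  exact free_ext _ _ _ _ _ hg

theorem lifts_homComplexFunctor_eval (P : ChainComplex (Rep.{u} k G) ℕ) (i : ℕ)
    [Projective (P.X i)] [Module.Finite (MonoidAlgebra k G) (P.X i).ρ.asModule] :
    LiftsFilteredColimits (homComplexFunctor P ⋙ HomologicalComplex.eval _ _ i) := by
  intro J _ _ D c hc (f : P.X i ⟶ c.pt)
  obtain ⟨n, p, _⟩ := exists_epi_free_of_finite (P.X i)
  obtain ⟨m, y, hy⟩ := exists_lift_of_finite hc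
    fun a : ULift.{u} (Fin n) ↦ (p ≫ f).hom (Finsupp.single a (.single 1 1))
  have key : freeLift k G _ y ≫ c.ι.app m = p ≫ f := by
    refine free_ext _ _ _ _ _ fun a ↦ ?_
    rw [← hy a]
    simp
  -- The lift exists on the free cover; a section of `p` carries it back to the projective module.
  refine ⟨m, Projective.factorThru (𝟙 _) p ≫ freeLift k G _ y, ?_⟩
  change (Projective.factorThru (𝟙 _) p ≫ freeLift k G _ y) ≫ c.ι.app m = f
  rw [Category.assoc, key, Projective.factorThru_comp_assoc, Category.id_comp]

end Rep

open Rep in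
theorem IsFPInftyOver.cohomologyFinitaryOver (h : IsFPInftyOver k G) (n : ℕ) :
    CohomologyFinitaryOver k G n := by
  obtain ⟨P, hP⟩ := h
  have hl i : LiftsFilteredColimits (homComplexFunctor P.complex ⋙
    HomologicalComplex.eval _ _ i) := lifts_homComplexFunctor_eval _ i
  have hd i : DetectsFilteredColimits (homComplexFunctor P.complex ⋙
    HomologicalComplex.eval _ _ i) := detects_homComplexFunctor_eval _ i
  exact preservesFilteredColimits_of_lifts_of_detects
    ((LiftsFilteredColimits.cochainComplex_homology hl hd n).of_iso (groupCohomologyNatIso P n).symm)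
    ((DetectsFilteredColimits.cochainComplex_homology hl hd n).of_iso
      (groupCohomologyNatIso P n).symm)

end HomComplex

/-! ### Shapiro's lemma and the coinduction sequence -/

section FiniteIndex

open Limits

variable {k G : Type u} [CommRing k] [Group G]

namespace Rep

variable (S : Subgroup G)

/-- Naturality of `Hom(Res P, -) ≅ Hom(P, Coind -)`. -/
noncomputable def homComplexFunctorResIso (P : ProjectiveResolution (Rep.trivial k G k)) :
    homComplexFunctor ((resFunctor S.subtype).mapProjectiveResolution P).complex ≅
      coindFunctor k S.subtype ⋙ homComplexFunctor P.complex :=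
  NatIso.ofComponents (fun A ↦ groupCohomology.linearYonedaObjResProjectiveResolutionIso P A)
    fun {A B} φ ↦ by
      ext i : 1
      exact ModuleCat.hom_ext <| LinearMap.ext fun (f : res S.subtype (P.complex.X i) ⟶ A) ↦ rfl

/-- Shapiro's lemma, naturally in the coefficients. -/
noncomputable def coindNatIso (n : ℕ) :
    coindFunctor.{u} k S.subtype ⋙ groupCohomology.functor k G n ≅
      groupCohomology.functor k S n :=
  Functor.isoWhiskerLeft _ (groupCohomologyNatIso (barResolution k G) n) ≪≫
    Functor.isoWhiskerRight (homComplexFunctorResIso S (barResolution k G)).symm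
      (HomologicalComplex.homologyFunctor _ _ n) ≪≫
    (groupCohomologyNatIso ((resFunctor S.subtype).mapProjectiveResolution (barResolution k G))
      n).symm

/-- The functor `M ↦ Coind Res M`. -/
noncomputable abbrev coindRes : Rep.{u} k G ⥤ Rep.{u} k G :=
  resFunctor S.subtype ⋙ coindFunctor.{u} k S.subtype

/-- The unit `M ⟶ Coind Res M`. -/
noncomputable abbrev coindUnit : 𝟭 (Rep.{u} k G) ⟶ coindRes S :=
  (resCoindAdjunction.{u} k S.subtype).unit

instance (M : Rep.{u} k G) : Mono ((coindUnit S).app M) := by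
  refine (mono_iff_injective _).2 fun x y h ↦ ?_
  -- The unit sends x to the function g ↦ gx, so evaluation at 1 recovers x.
  have h₁ : M.ρ 1 x = M.ρ 1 y := congr_fun (congr_arg Subtype.val h) 1
  simpa using h₁

/-- The functorial exact sequence `0 ⟶ M ⟶ Coind Res M ⟶ M' ⟶ 0`. -/
noncomputable abbrev coindSequence : ShortComplex (Rep.{u} k G ⥤ Rep.{u} k G) :=
  .mk (coindUnit S) (cokernel.π (coindUnit S)) (cokernel.condition _)

theorem coindSequence_shortExact (M : Rep.{u} k G) :
    ((coindSequence S).map ((evaluation _ _).obj M)).ShortExact := by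
  have : Mono (coindUnit (k := k) S) := NatTrans.mono_of_mono_app _
  have h : (coindSequence (k := k) S).ShortExact :=
    { exact := ShortComplex.exact_of_g_is_cokernel _ (cokernelIsCokernel _)
      mono_f := this
      epi_g := inferInstance }
  exact h.map_of_exact _

/-- A cokernel is a colimit, and colimits commute with colimits. -/
theorem preservesColimits_cokernel {C D : Type*} [Category* C] [Category* D] [Abelian D]
    {F F' : C ⥤ D} [PreservesColimitsOfSize.{u, u} F] [PreservesColimitsOfSize.{u, u} F']
    (η : F ⟶ F') : PreservesColimitsOfSize.{u, u} (cokernel η) := by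
  have : PreservesColimitsOfSize.{u, u} (parallelPair η 0).flip :=
    preservesColimits_of_evaluation _ fun i ↦ by
      cases i
      · exact preservesColimits_of_natIso (F := F) (NatIso.ofComponents (fun _ ↦ Iso.refl _))
      · exact preservesColimits_of_natIso (F := F') (NatIso.ofComponents (fun _ ↦ Iso.refl _))
  have : PreservesColimitsOfSize.{u, u} (colim : (WalkingParallelPair ⥤ D) ⥤ D) :=
    colimConstAdj.leftAdjoint_preservesColimits
  exact preservesColimits_of_natIso (colimitIsoFlipCompColim (parallelPair η 0)).symm

/-- For finite index, coinduction is also a left adjoint, so it preserves colimits. -/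
instance [S.FiniteIndex] :
    PreservesColimitsOfSize.{u, u} (cokernel (coindUnit (k := k) S)) :=
  have : PreservesColimitsOfSize.{u, u} (coindFunctor.{u} k S.subtype) :=
    (Adjunction.ofIsLeftAdjoint _).leftAdjoint_preservesColimits
  preservesColimits_cokernel _

/-- The cokernel of `M ⟶ Coind Res M`. -/
noncomputable abbrev coindCok : Rep.{u} k G ⥤ Rep.{u} k G := cokernel (coindUnit (k := k) S)

/-- The projection `Coind Res M ⟶ M'`. -/
noncomputable abbrev coindProj : coindRes (k := k) S ⟶ coindCok S := cokernel.π _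

/-- The connecting map of the sequence `0 ⟶ M ⟶ Coind Res M ⟶ M' ⟶ 0`. -/
noncomputable def coindδ (M : Rep.{u} k G) (n : ℕ) :
    (groupCohomology.functor k G n).obj ((coindCok S).obj M) ⟶
      (groupCohomology.functor k G (n + 1)).obj M :=
  groupCohomology.δ (coindSequence_shortExact S M) n (n + 1) rfl

variable {S}

theorem coindδ_naturality {M N : Rep.{u} k G} (f : M ⟶ N) (n : ℕ)
    (w : (groupCohomology.functor k G n).obj ((coindCok S).obj M)) :
    coindδ S N n ((groupCohomology.functor k G n).map ((coindCok S).map f) w) =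
      (groupCohomology.functor k G (n + 1)).map f (coindδ S M n w) :=
  (congr($(groupCohomology.δ_naturality (coindSequence_shortExact S M)
    (coindSequence_shortExact S N)
    ((coindSequence (k := k) S).mapNatTrans ((evaluation _ _).map f)) n (n + 1) rfl) w)).symm

theorem exists_coindδ_eq {M : Rep.{u} k G} {n : ℕ}
    (y : (groupCohomology.functor k G (n + 1)).obj M)
    (hy : (groupCohomology.functor k G (n + 1)).map ((coindUnit S).app M) y = 0) :
    ∃ w, coindδ S M n w = y :=
  (ShortComplex.moduleCat_exact_iff _).1
    (groupCohomology.mapShortComplex₁_exact (coindSequence_shortExact S M) rfl) y hy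

theorem exists_map_coindUnit_eq {M : Rep.{u} k G} {n : ℕ}
    (v : (groupCohomology.functor k G n).obj ((coindRes S).obj M))
    (hv : (groupCohomology.functor k G n).map ((coindProj S).app M) v = 0) :
    ∃ y, (groupCohomology.functor k G n).map ((coindUnit S).app M) y = v :=
  (ShortComplex.moduleCat_exact_iff _).1
    (groupCohomology.mapShortComplex₂_exact (coindSequence_shortExact S M) n) v hv

theorem exists_map_coindProj_eq {M : Rep.{u} k G} {n : ℕ}
    (w : (groupCohomology.functor k G n).obj ((coindCok S).obj M))
    (hw : coindδ S M n w = 0) :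
    ∃ v, (groupCohomology.functor k G n).map ((coindProj S).app M) v = w :=
  (ShortComplex.moduleCat_exact_iff _).1
    (groupCohomology.mapShortComplex₃_exact (coindSequence_shortExact S M) rfl) w hw

theorem coindδ_map_coindProj {M : Rep.{u} k G} {n : ℕ}
    (v : (groupCohomology.functor k G n).obj ((coindRes S).obj M)) :
    coindδ S M n ((groupCohomology.functor k G n).map ((coindProj S).app M) v) = 0 :=
  congr($((groupCohomology.mapShortComplex₃ (coindSequence_shortExact S M) rfl).zero) v)

theorem map_coindProj_map_coindUnit {M : Rep.{u} k G} {n : ℕ}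
    (y : (groupCohomology.functor k G n).obj M) :
    (groupCohomology.functor k G n).map ((coindProj S).app M)
      ((groupCohomology.functor k G n).map ((coindUnit S).app M) y) = 0 :=
  congr($((groupCohomology.mapShortComplex₂ ((coindSequence (k := k) S).map
    ((evaluation _ _).obj M)) n).zero) y)

theorem map_coindUnit_zero_injective (M : Rep.{u} k G) :
    Function.Injective ((groupCohomology.functor k G 0).map ((coindUnit S).app M)) :=
  (ModuleCat.mono_iff_injective _).1
    (groupCohomology.mono_map_0_of_mono ((coindUnit S).app M))

end Rep
end FiniteIndex

/-! ### Ascent of finitariness from a subgroup of finite index -/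

section FiniteIndexFinitary

open Limits Rep groupCohomology

variable {k G : Type u} [CommRing k] [Group G] {S : Subgroup G}

theorem groupCohomology.functor_map_comp_apply {n : ℕ} {L M N : Rep.{u} k G} (f : L ⟶ M)
    (g : M ⟶ N) (y : (functor k G n).obj L) :
    (functor k G n).map (f ≫ g) y = (functor k G n).map g ((functor k G n).map f y) := by
  rw [Functor.map_comp, ConcreteCategory.comp_apply]

theorem Rep.map_coindUnit_map {n : ℕ} {M N : Rep.{u} k G} (f : M ⟶ N)
    (y : (functor k G n).obj M) :
    (functor k G n).map ((coindUnit S).app N) ((functor k G n).map f y) =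
      (functor k G n).map ((coindRes S).map f)
        ((functor k G n).map ((coindUnit S).app M) y) := by
  rw [← functor_map_comp_apply, ← functor_map_comp_apply]
  exact congr((functor k G n).map $((coindUnit S).naturality f) y)

theorem Rep.map_coindProj_map {n : ℕ} {M N : Rep.{u} k G} (f : M ⟶ N)
    (y : (functor k G n).obj ((coindRes S).obj M)) :
    (functor k G n).map ((coindProj S).app N) ((functor k G n).map ((coindRes S).map f) y) =
      (functor k G n).map ((coindCok S).map f)
        ((functor k G n).map ((coindProj S).app M) y) := by
  rw [← functor_map_comp_apply, ← functor_map_comp_apply]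
  exact congr((functor k G n).map $((coindProj S).naturality f) y)

theorem lifts_coindRes {n : ℕ} (hl : LiftsFilteredColimits (functor.{u} k S n)) :
    LiftsFilteredColimits (coindRes S ⋙ functor.{u} k G n) :=
  (hl.comp (resFunctor S.subtype)).of_iso
    (Functor.isoWhiskerLeft (resFunctor S.subtype) (coindNatIso S n).symm)

theorem detects_coindRes {n : ℕ} (hd : DetectsFilteredColimits (functor.{u} k S n)) :
    DetectsFilteredColimits (coindRes S ⋙ functor.{u} k G n) :=
  (hd.comp (resFunctor S.subtype)).of_iso
    (Functor.isoWhiskerLeft (resFunctor S.subtype) (coindNatIso S n).symm)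

variable [S.FiniteIndex]

theorem detects_functor_of_finiteIndex
    (hl : ∀ n, LiftsFilteredColimits (functor.{u} k S n))
    (hd : ∀ n, DetectsFilteredColimits (functor.{u} k S n)) (n : ℕ) :
    DetectsFilteredColimits (functor.{u} k G n) := by
  induction n with
  | zero =>
    intro J _ _ D c hc j y hy
    obtain ⟨j', f, hf⟩ := detects_coindRes (hd 0) J D c hc j
      ((functor k G 0).map ((coindUnit S).app _) y)
      ((map_coindUnit_map _ _).symm.trans (by rw [hy, map_zero]))
    refine ⟨j', f, map_coindUnit_zero_injective (S := S) _ ?_⟩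
    rw [map_coindUnit_map, map_zero]
    exact hf
  | succ n ih =>
    intro J _ _ D c hc j y hy
    obtain ⟨ι, hι, hw⟩ : ∃ ι : ∀ j, D.obj j ⟶ c.pt, (∀ j, c.ι.app j = ι j) ∧
      ∀ {i j : J} (f : i ⟶ j), D.map f ≫ ι j = ι i := ⟨c.ι.app, fun _ ↦ rfl, c.w⟩
    rw [hι] at hy
    obtain ⟨j₁, f₁, hf₁⟩ := detects_coindRes (hd (n + 1)) J D c hc j
      ((functor k G (n + 1)).map ((coindUnit S).app _) y)
      ((map_coindUnit_map _ _).symm.trans (by rw [hι, hy, map_zero]))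
    replace hf₁ := (map_coindUnit_map (S := S) (D.map f₁) y).trans hf₁
    -- Now y = δw at this stage. Over the colimit δw = 0, so w comes from a class v in the coinduced
    -- module; v descends to a stage, and by induction w agrees with it at a later one, where δw
    -- vanishes.
    obtain ⟨w, hw₁⟩ := exists_coindδ_eq _ hf₁
    obtain ⟨v, hv⟩ := exists_map_coindProj_eq (S := S)
      ((functor k G n).map ((coindCok S).map (ι j₁)) w) (by
        rw [coindδ_naturality, hw₁, ← functor_map_comp_apply, hw, hy])
    obtain ⟨j₂, v₂, hv₂⟩ : ∃ (j : J) (v' : (functor k G n).obj ((coindRes S).obj (D.obj j))),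
        (functor k G n).map ((coindRes S).map (ι j)) v' = v := by
      obtain ⟨j, v', h⟩ := lifts_coindRes (hl n) J D c hc v
      exact ⟨j, v', hι j ▸ h⟩
    let m := IsFiltered.max j₁ j₂
    let p : j₁ ⟶ m := IsFiltered.leftToMax j₁ j₂
    let q : j₂ ⟶ m := IsFiltered.rightToMax j₁ j₂
    obtain ⟨m', r, hr⟩ : ∃ (m' : J) (r : m ⟶ m'),
        (functor k G n).map ((coindCok S).map (D.map r))
          ((functor k G n).map ((coindCok S).map (D.map p)) w -
          (functor k G n).map ((coindCok S).map (D.map q))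
            ((functor k G n).map ((coindProj S).app _) v₂)) = 0 := by
      refine (ih.comp (coindCok S)) J D c hc m _ ?_
      rw [hι]
      change (functor k G n).map ((coindCok S).map (ι m)) _ = 0
      rw [map_sub, ← functor_map_comp_apply, ← functor_map_comp_apply, ← Functor.map_comp,
        ← Functor.map_comp, hw, hw, ← hv, ← hv₂, map_coindProj_map, sub_self]
    refine ⟨m', f₁ ≫ p ≫ r, ?_⟩
    rw [D.map_comp, functor_map_comp_apply, ← hw₁, ← coindδ_naturality, D.map_comp,
      Functor.map_comp, functor_map_comp_apply]
    rw [map_sub, sub_eq_zero] at hr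
    rw [hr, ← map_coindProj_map, ← map_coindProj_map, coindδ_map_coindProj]

theorem lifts_functor_of_finiteIndex
    (hl : ∀ n, LiftsFilteredColimits (functor.{u} k S n))
    (hd : ∀ n, DetectsFilteredColimits (functor.{u} k S n)) (n : ℕ) :
    LiftsFilteredColimits (functor.{u} k G n) := by
  -- Lifting modulo the kernel of the map to Hⁿ(Coind Res -): lift the image of x, then move to a
  -- stage where the lift dies in Hⁿ of the cokernel. In degree 0 that kernel is zero; in degree n +
  -- 1 it is the image of δ, handled by induction.
  have key : ∀ n (J : Type u) [SmallCategory J] [IsFiltered J] (D : J ⥤ Rep.{u} k G)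
      (c : Cocone D), IsColimit c → ∀ x : (functor k G n).obj c.pt,
      ∃ (j : J) (y : (functor k G n).obj (D.obj j)),
        (functor k G n).map ((coindUnit S).app c.pt)
          ((functor k G n).map (Y := c.pt) (c.ι.app j) y) =
        (functor k G n).map ((coindUnit S).app c.pt) x := by
    intro n J _ _ D c hc x
    obtain ⟨j, v, hv⟩ : ∃ (j : J) (v : (functor k G n).obj ((coindRes S).obj (D.obj j))),
        (functor k G n).map (Y := (coindRes S).obj c.pt) ((coindRes S).map (c.ι.app j)) v =
          (functor k G n).map ((coindUnit S).app c.pt) x :=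
      lifts_coindRes (hl n) J D c hc _
    obtain ⟨j', f, hf⟩ := (detects_functor_of_finiteIndex hl hd n).comp (coindCok S) J D c hc j
      ((functor k G n).map ((coindProj S).app _) v)
      ((map_coindProj_map _ _).symm.trans
        ((congrArg _ hv).trans (map_coindProj_map_coindUnit _)))
    obtain ⟨y, hy⟩ := exists_map_coindUnit_eq _ ((map_coindProj_map (S := S) (D.map f) v).trans hf)
    refine ⟨j', y, ?_⟩
    rw [map_coindUnit_map, hy, ← functor_map_comp_apply, ← Functor.map_comp, c.w]
    exact hv
  induction n with
  | zero =>
    intro J _ _ D c hc x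
    obtain ⟨j, y, hy⟩ := key 0 J D c hc x
    exact ⟨j, y, map_coindUnit_zero_injective _ hy⟩
  | succ n ih =>
    intro J _ _ D c hc x
    obtain ⟨ι, hι, hw⟩ : ∃ ι : ∀ j, D.obj j ⟶ c.pt, (∀ j, c.ι.app j = ι j) ∧
      ∀ {i j : J} (f : i ⟶ j), D.map f ≫ ι j = ι i := ⟨c.ι.app, fun _ ↦ rfl, c.w⟩
    obtain ⟨j, y, hy⟩ := key (n + 1) J D c hc x
    rw [hι] at hy
    obtain ⟨w, hw₁⟩ := exists_coindδ_eq (S := S) (x - (functor k G (n + 1)).map (ι j) y)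
      (by rw [map_sub, hy, sub_self])
    obtain ⟨i, v, hv⟩ : ∃ (i : J) (v : (functor k G n).obj ((coindCok S).obj (D.obj i))),
        (functor k G n).map ((coindCok S).map (ι i)) v = w := by
      obtain ⟨i, v, h⟩ := ih.comp (coindCok S) J D c hc w
      exact ⟨i, v, hι i ▸ h⟩
    let m := IsFiltered.max i j
    let p : i ⟶ m := IsFiltered.leftToMax i j
    let q : j ⟶ m := IsFiltered.rightToMax i j
    refine ⟨m, (functor k G (n + 1)).map (D.map p) (coindδ S _ n v) +
      (functor k G (n + 1)).map (D.map q) y, ?_⟩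
    rw [hι, map_add, ← functor_map_comp_apply, ← functor_map_comp_apply, hw, hw,
      ← coindδ_naturality, hv, hw₁, sub_add_cancel]

theorem cohomologyFinitaryOver_of_finiteIndex
    (h : ∀ n, CohomologyFinitaryOver k S n) (n : ℕ) : CohomologyFinitaryOver k G n := by
  have hl n : LiftsFilteredColimits (functor.{u} k S n) :=
    have : PreservesFilteredColimits (functor.{u} k S n) := h n
    lifts_of_preservesFilteredColimits
  have hd n : DetectsFilteredColimits (functor.{u} k S n) :=
    have : PreservesFilteredColimits (functor.{u} k S n) := h n
    detects_of_preservesFilteredColimits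
  exact preservesFilteredColimits_of_lifts_of_detects (lifts_functor_of_finiteIndex hl hd n)
    (detects_functor_of_finiteIndex hl hd n)

end FiniteIndexFinitary

/-! ### Transport along isomorphisms; the product with a finite group -/

section GroupIso

open Limits Rep groupCohomology

variable {k G G' : Type u} [CommRing k] [Group G] [Group G']

theorem CohomologyFinitaryOver.of_mulEquiv (e : G ≃* G') {n : ℕ}
    (h : CohomologyFinitaryOver k G n) : CohomologyFinitaryOver k G' n := by
  have h' : PreservesFilteredColimits (functor.{u} k G n) := h
  have (A : Rep.{u} k G') :
      IsIso ((resNatTrans (k := k) (e : G →* G') n).app A) :=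
    (mapIso (A := A) (B := res (e : G →* G') A) e (LinearEquiv.refl k A) (fun _ ↦ rfl)
      n).isIso_inv
  have := NatIso.isIso_of_isIso_app (resNatTrans (k := k) (e : G →* G') n)
  exact preservesFilteredColimits_of_lifts_of_detects
    ((lifts_of_preservesFilteredColimits.comp _).of_iso
      (asIso (resNatTrans (k := k) (e : G →* G') n)).symm)
    ((detects_of_preservesFilteredColimits.comp _).of_iso
      (asIso (resNatTrans (k := k) (e : G →* G') n)).symm)

theorem IsFPInftyOver.cohomologyFinitaryOver_prod (h : IsFPInftyOver k G) (Q : Type u) [Group Q]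
    [Finite Q] (n : ℕ) : CohomologyFinitaryOver k (G × Q) n := by
  have : (MonoidHom.inl G Q).range.FiniteIndex := by
    -- The copy of G is the kernel of the projection to the finite group Q, hence of finite index.
    have h : (MonoidHom.inl G Q).range = (MonoidHom.snd G Q).ker := by
      ext ⟨g, q⟩
      simp [Subgroup.mem_prod, Prod.ext_iff, eq_comm]
    exact h ▸ inferInstance
  refine cohomologyFinitaryOver_of_finiteIndex (S := (MonoidHom.inl G Q).range) (fun m ↦ ?_) n
  exact (h.cohomologyFinitaryOver m).of_mulEquiv
    (MonoidHom.ofInjective (fun a b hab ↦ congr_arg Prod.fst hab))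

end GroupIso

/-! ### Nonzero cohomology of a finite group in every degree -/

section Nonvanishing

open Limits Rep groupCohomology

variable {k G : Type u} [CommRing k] [Group G]

theorem groupCohomology.isZero_coind_bot_succ (B : Rep.{u} k (⊥ : Subgroup G)) (n : ℕ) :
    IsZero (groupCohomology (coind.{u} (⊥ : Subgroup G).subtype B) (n + 1)) :=
  (isZero_groupCohomology_succ_of_subsingleton B n).of_iso (coindIso B (n + 1))

/-- A map from a module coinduced from the trivial subgroup to a trivial representation is divisible
by the group order on invariants. -/
theorem Rep.exists_map_invariants_eq_card_smul [Finite G] {V : Type u} [AddCommGroup V]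
    [Module k V] (B : Rep.{u} k (⊥ : Subgroup G))
    (φ : coind.{u} (⊥ : Subgroup G).subtype B ⟶ Rep.trivial k G V)
    (f : coind.{u} (⊥ : Subgroup G).subtype B)
    (hf : ∀ g, (coind.{u} (⊥ : Subgroup G).subtype B).ρ g f = f) :
    ∃ v : V, φ.hom f = Nat.card G • v := by
  classical
  have := Fintype.ofFinite G
  have hconst (g : G) : f.1 g = f.1 1 := by
    have h : f.1 (1 * g) = f.1 1 := congr_fun (congr_arg Subtype.val (hf g)) 1
    rwa [one_mul] at h
  -- An invariant function is constant, hence the sum of all translates of the function `d`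
  -- supported at 1; each translate has the same image in a trivial representation.
  let d : coind.{u} (⊥ : Subgroup G).subtype B :=
    ⟨Pi.single 1 (f.1 1), fun s g ↦ by
      obtain rfl := Subsingleton.elim s 1
      simp⟩
  have hd (g x : G) : ((coind.{u} (⊥ : Subgroup G).subtype B).ρ g d).1 x =
      (Pi.single 1 (f.1 1) : G → B) (x * g) := rfl
  have hsum : f = ∑ g : G, (coind.{u} (⊥ : Subgroup G).subtype B).ρ g d := by
    ext x
    rw [hconst, AddSubmonoidClass.coe_finsetSum, Finset.sum_apply,
      Finset.sum_eq_single x⁻¹]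
    · rw [hd, mul_inv_cancel, Pi.single_eq_same]
    · intro g _ hg
      have : x * g ≠ 1 := fun h ↦ hg (eq_inv_of_mul_eq_one_right h)
      rw [hd, Pi.single_eq_of_ne this]
    · simp
  refine ⟨φ.hom d, ?_⟩
  have hφ (g : G) : φ.hom ((coind.{u} (⊥ : Subgroup G).subtype B).ρ g d) = φ.hom d :=
    hom_comm_apply φ g d
  conv_lhs => rw [hsum]
  rw [map_sum, Finset.sum_congr rfl fun g _ ↦ hφ g, Finset.sum_const, Finset.card_univ,
    Nat.card_eq_fintype_card]

theorem groupCohomology.map_zero_H0Iso_hom {A B : Rep.{u} k G} (φ : A ⟶ B)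
    (y : groupCohomology A 0) :
    ((H0Iso B).hom ((functor k G 0).map φ y)).1 = φ.hom ((H0Iso A).hom y).1 :=
  congr_arg Subtype.val congr($(map_id_comp_H0Iso_hom φ) y)

/-- For a finite group whose order is not invertible in `k`, each degree has a cohomology class
that does not come from any module coinduced from the trivial subgroup. -/
theorem groupCohomology.exists_not_mem_range_coind [Finite G] (hG : ¬ IsUnit (Nat.card G : k))
    (n : ℕ) : ∃ (A : Rep.{u} k G) (x : (functor k G n).obj A),
      ∀ (B : Rep.{u} k (⊥ : Subgroup G)) (φ : coind.{u} (⊥ : Subgroup G).subtype B ⟶ A) y,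
        (functor k G n).map φ y ≠ x := by
  induction n with
  | zero =>
    refine ⟨Rep.trivial k G k, (H0Iso (Rep.trivial k G k)).inv ⟨1, fun _ ↦ rfl⟩, ?_⟩
    intro B φ y hy
    have h := map_zero_H0Iso_hom φ y
    rw [hy] at h
    obtain ⟨v, hv⟩ := exists_map_invariants_eq_card_smul B φ _ ((H0Iso _).hom y).2
    rw [hv] at h
    simp at h
    -- If 1 came from a coinduced module, it would be |G| times some `v`.
    exact hG (.of_mul_eq_one v h.symm)
  | succ n ih =>
    classical
    obtain ⟨A, x, hx⟩ := ih
    let p : (coindRes (⊥ : Subgroup G)).obj A ⟶ A :=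
      (coindResAdjunction.{u} k (⊥ : Subgroup G)).counit.app A
    have hp : Epi p := (coindResAdjunction.{u} k (⊥ : Subgroup G)).counit_epi_of_R_faithful A
    have hX : (ShortComplex.mk (kernel.ι p) p (kernel.condition p)).ShortExact :=
      { exact := ShortComplex.exact_of_f_is_kernel _ (kernelIsKernel p)
        mono_f := inferInstance
        epi_g := hp }
    -- Coinduced modules have no cohomology in degree n + 1, so a class coming from one is zero. But
    -- δx = 0 would make x come from Coind Res A. This is why the induction carries more than
    -- nonvanishing.
    refine ⟨kernel p, δ hX n (n + 1) rfl x, fun B φ y hy ↦ ?_⟩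
    have : Subsingleton ((functor k G (n + 1)).obj (coind.{u} (⊥ : Subgroup G).subtype B)) :=
      ModuleCat.subsingleton_of_isZero (isZero_coind_bot_succ B n)
    obtain rfl := Subsingleton.elim y 0
    rw [map_zero] at hy
    obtain ⟨v, hv⟩ := (ShortComplex.moduleCat_exact_iff _).1
      (mapShortComplex₃_exact hX rfl) x hy.symm
    exact hx _ p v hv

theorem groupCohomology.exists_ne_zero [Finite G] (hG : ¬ IsUnit (Nat.card G : k)) (n : ℕ) :
    ∃ (A : Rep.{u} k G) (x : (functor k G n).obj A), x ≠ 0 := by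
  obtain ⟨A, x, hx⟩ := exists_not_mem_range_coind hG n
  refine ⟨A, x, ?_⟩
  rintro rfl
  exact hx (res (⊥ : Subgroup G).subtype A) 0 0 (map_zero _)

end Nonvanishing

/-! ### Centralizing elements act trivially on restricted classes -/

section Centralizer

open Limits Rep groupCohomology

variable {k G Q : Type u} [CommRing k] [Group G] [Group Q] (i : Q →* G)

/-- An element of `G` centralizing the image of `Q` acts on representations of `G` by
`Q`-equivariant maps. -/
def Rep.centralizerAct {g : G} (hg : ∀ q, Commute g (i q)) (M : Rep.{u} k G) :
    res i M ⟶ res i M :=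
  ofHom (σ := (res i M).ρ) (ρ := (res i M).ρ) ⟨M.ρ g, fun q ↦ by
    rw [coe_res_obj_ρ', ← Module.End.mul_eq_comp, ← Module.End.mul_eq_comp, ← map_mul, ← map_mul,
      (hg q).eq]⟩

/-- Elements centralizing the image of `Q` act trivially on classes restricted from `G`. -/
theorem groupCohomology.map_centralizerAct {g : G} (hg : ∀ q, Commute g (i q)) (n : ℕ)
    (M : Rep.{u} k G) :
    map i (centralizerAct i hg M) n = map i (𝟙 (res i M)) n := by
  induction n generalizing M with
  | zero =>
    ext y
    refine (H0Iso (res i M)).toLinearEquiv.injective (Subtype.ext ?_)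
    have h (φ : res i M ⟶ res i M) :
        ((H0Iso (res i M)).hom (map i φ 0 y)).1 = φ.hom ((H0Iso M).hom y).1 :=
      congr($(map_H0Iso_hom_f i φ) y)
    -- In degree 0 a restricted class is a G-invariant element, fixed by g.
    exact (h _).trans ((((H0Iso M).hom y).2 g).trans (h (𝟙 _)).symm)
  | succ n ih =>
    ext y
    have : Subsingleton ((functor k G (n + 1)).obj ((coindRes (⊥ : Subgroup G)).obj M)) :=
      ModuleCat.subsingleton_of_isZero (isZero_coind_bot_succ _ n)
    -- Coinduction from the trivial subgroup kills positive degrees, so every class is a δw. Both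
    -- maps being compared are natural in the module, hence commute with δ.
    obtain ⟨w, rfl⟩ := exists_coindδ_eq (S := ⊥) y (Subsingleton.elim _ _)
    have hX := coindSequence_shortExact (⊥ : Subgroup G) M
    have key (φ : ∀ N : Rep.{u} k G, res i N ⟶ res i N)
        (hφ : ∀ {N N' : Rep.{u} k G} (f : N ⟶ N'),
          (resFunctor i).map f ≫ φ N' = φ N ≫ (resFunctor i).map f) :
        map i (φ M) (n + 1) (coindδ ⊥ M n w) =
          δ ((shortExact_res i).2 hX) n (n + 1) rfl (map i (φ _) n w) := by
      have comm {N N' : Rep.{u} k G} (f : N ⟶ N') :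
          cochainsMap i (φ N) ≫ (cochainsFunctor k Q).map ((resFunctor i).map f) =
            (cochainsFunctor k G).map f ≫ cochainsMap i (φ N') :=
        (congr(cochainsMap i $(hφ f))).symm
      let Φ : ((coindSequence (k := k) (⊥ : Subgroup G)).map ((evaluation _ _).obj M)).map
            (cochainsFunctor k G) ⟶
          (((coindSequence (k := k) (⊥ : Subgroup G)).map ((evaluation _ _).obj M)).map
            (resFunctor i)).map (cochainsFunctor k Q) :=
        { τ₁ := cochainsMap i (φ _)
          τ₂ := cochainsMap i (φ _)
          τ₃ := cochainsMap i (φ _)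
          comm₁₂ := comm _
          comm₂₃ := comm _ }
      exact congr($(HomologicalComplex.HomologySequence.δ_naturality Φ
        (map_cochainsFunctor_shortExact hX)
        (map_cochainsFunctor_shortExact ((shortExact_res i).2 hX)) n (n + 1) rfl) w)
    refine (key (centralizerAct i hg) fun f ↦ ?_).trans
      ((congr_arg _ ?_).trans (key (fun N ↦ 𝟙 _) fun f ↦ ?_).symm)
    · ext x
      exact (hom_comm_apply f g x).symm
    · exact congr($(ih _) w)
    · rw [Category.comp_id, Category.id_comp]

end Centralizer

/-! ### An inflated module as a filtered colimit of coset modules -/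

section Cosets

open Limits Rep groupCohomology

variable {k H Q : Type u} [CommRing k] [Group H] [Group Q]

namespace Rep

/-- The action of `H × Q` on the finitely supported functions `H/K → A`, where `A` is a
representation of `Q`. -/
noncomputable def cosetAction (K : Subgroup H) (A : Rep.{u} k Q) :
    Representation k (H × Q) (H ⧸ K →₀ A) where
  toFun p := Finsupp.lmapDomain A k (p.1 • ·) ∘ₗ Finsupp.mapRange.linearMap (A.ρ p.2)
  map_one' := by ext; simp
  map_mul' p q := by ext; simp [mul_smul]

theorem cosetAction_apply (K : Subgroup H) (A : Rep.{u} k Q) (p : H × Q) (x : H ⧸ K →₀ A) :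
    cosetAction K A p x = Finsupp.mapDomain (p.1 • ·) (Finsupp.mapRange.linearMap (A.ρ p.2) x) :=
  rfl

theorem cosetAction_single (K : Subgroup H) (A : Rep.{u} k Q) (p : H × Q) (c : H ⧸ K) (a : A) :
    cosetAction K A p (Finsupp.single c a) = Finsupp.single (p.1 • c) (A.ρ p.2 a) := by
  simp [cosetAction_apply]

theorem cosetAction_apply_smul (K : Subgroup H) (A : Rep.{u} k Q) (p : H × Q) (c : H ⧸ K)
    (x : H ⧸ K →₀ A) : cosetAction K A p x (p.1 • c) = A.ρ p.2 (x c) := by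
  rw [cosetAction_apply, Finsupp.mapDomain_apply (MulAction.injective p.1)]
  rfl

/-- The representation `k[H/K] ⊗ A` of `H × Q`, realized as finitely supported functions
`H/K → A`. -/
noncomputable abbrev cosetRep (K : Subgroup H) (A : Rep.{u} k Q) : Rep.{u} k (H × Q) :=
  of (cosetAction K A)

/-- The map `k[H/K] ⊗ A ⟶ k[H/K'] ⊗ A` for `K ≤ K'`. -/
noncomputable def cosetMap {K K' : Subgroup H} (h : K ≤ K') (A : Rep.{u} k Q) :
    cosetRep K A ⟶ cosetRep K' A :=
  ofHom ⟨Finsupp.lmapDomain A k (Subgroup.quotientMapOfLE h), fun p ↦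
    Finsupp.lhom_ext fun c a ↦ by
      induction c using QuotientGroup.induction_on
      simp [cosetAction_single]⟩

/-- The augmentation `k[H/K] ⊗ A ⟶ A`. -/
noncomputable def cosetSum (K : Subgroup H) (A : Rep.{u} k Q) :
    cosetRep K A ⟶ res (MonoidHom.snd H Q) A :=
  ofHom (σ := (res (MonoidHom.snd H Q) A).ρ)
    ⟨Finsupp.lsum k fun _ ↦ (LinearMap.id : A →ₗ[k] A), fun p ↦ Finsupp.lhom_ext fun c a ↦ by
      simp [cosetAction_single]⟩

theorem cosetMap_single {K K' : Subgroup H} (h : K ≤ K') (A : Rep.{u} k Q) (x : H) (a : A) :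
    (cosetMap h A).hom (Finsupp.single (x : H ⧸ K) a) = Finsupp.single (x : H ⧸ K') a :=
  Finsupp.mapDomain_single

theorem cosetSum_single (K : Subgroup H) (A : Rep.{u} k Q) (c : H ⧸ K) (a : A) :
    (cosetSum K A).hom (Finsupp.single c a) = a := by
  change Finsupp.lsum k (fun _ ↦ (LinearMap.id : A →ₗ[k] A)) (Finsupp.single c a) = a
  simp

theorem cosetRep_hom_ext {K : Subgroup H} {A : Rep.{u} k Q} {B : Rep.{u} k (H × Q)}
    {f g : cosetRep K A ⟶ B}
    (h : ∀ (x : H) (a : A), f.hom (Finsupp.single (x : H ⧸ K) a) =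
      g.hom (Finsupp.single (x : H ⧸ K) a)) : f = g := by
  refine Rep.hom_ext (Representation.IntertwiningMap.ext (Finsupp.lhom_ext fun c a ↦ ?_))
  induction c using QuotientGroup.induction_on
  exact h _ a

theorem cosetMap_comp_cosetSum {K K' : Subgroup H} (h : K ≤ K') (A : Rep.{u} k Q) :
    cosetMap h A ≫ cosetSum K' A = cosetSum K A :=
  cosetRep_hom_ext fun x a ↦ by
    change (cosetSum K' A).hom ((cosetMap h A).hom (Finsupp.single (x : H ⧸ K) a)) = _
    rw [cosetMap_single, cosetSum_single, cosetSum_single]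

/-- The diagram of the `k[H/K] ⊗ A` with `K` running through finitely generated subgroups. -/
noncomputable def cosetDiagram (A : Rep.{u} k Q) : Finset H ⥤ Rep.{u} k (H × Q) where
  obj T := cosetRep (Subgroup.closure T) A
  map f := cosetMap (Subgroup.closure_mono (Finset.coe_subset.2 f.le)) A
  map_id T := cosetRep_hom_ext fun x a ↦ cosetMap_single _ A x a
  map_comp f g := cosetRep_hom_ext fun x a ↦ by
    refine (cosetMap_single _ A x a).trans (Eq.symm ?_)
    exact (congr_arg _ (cosetMap_single _ A x a)).trans (cosetMap_single _ A x a)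

/-- The augmentations as a cocone. -/
noncomputable def cosetCocone (A : Rep.{u} k Q) : Cocone (cosetDiagram (H := H) A) where
  pt := res (MonoidHom.snd H Q) A
  ι :=
    { app := fun (T : Finset H) ↦ cosetSum (Subgroup.closure (T : Set H)) A
      naturality := fun (_ _ : Finset H) f ↦ (cosetMap_comp_cosetSum (Subgroup.closure_mono
        (Finset.coe_subset.2 f.le)) A).trans (Category.comp_id _).symm }

theorem cosetCocone_ι_single {A : Rep.{u} k Q} (s : Cocone (cosetDiagram (H := H) A))
    {T T' : Finset H} (h : T ≤ T') (x : H) (a : A) :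
    (s.ι.app T').hom (Finsupp.single (x : H ⧸ Subgroup.closure (T' : Set H)) a) =
      (s.ι.app T).hom (Finsupp.single (x : H ⧸ Subgroup.closure (T : Set H)) a) := by
  rw [← s.w (homOfLE h)]
  exact congr_arg (s.ι.app T').hom (cosetMap_single _ A x a).symm

/-- Once x is adjoined to the generators, its coset is that of 1: in the colimit all cosets merge.
-/
theorem cosetCocone_ι_single_one {A : Rep.{u} k Q} (s : Cocone (cosetDiagram (H := H) A))
    (T : Finset H) (x : H) (a : A) :
    (s.ι.app T).hom (Finsupp.single (x : H ⧸ Subgroup.closure (T : Set H)) a) =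
      (s.ι.app ∅).hom
        (Finsupp.single ((1 : H) : H ⧸ Subgroup.closure ((∅ : Finset H) : Set H)) a) := by
  classical
  rw [← cosetCocone_ι_single s (Finset.empty_subset (insert x T)),
    ← cosetCocone_ι_single s (Finset.subset_insert x T)]
  congr 2
  refine QuotientGroup.eq.2 ?_
  simpa using Subgroup.subset_closure (Finset.mem_coe.2 (Finset.mem_insert_self x T))

/-- `A`, inflated to `H × Q`, is the colimit of the `k[H/K] ⊗ A` over the finitely generated
subgroups `K` of `H`. -/
noncomputable def isColimitCosetCocone (A : Rep.{u} k Q) :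
    IsColimit (cosetCocone A : Cocone (cosetDiagram (H := H) A)) where
  desc s := ofHom (ρ := (res (MonoidHom.snd H Q) A).ρ)
    ⟨(s.ι.app ∅).hom.toLinearMap ∘ₗ
      Finsupp.lsingle ((1 : H) : H ⧸ Subgroup.closure ((∅ : Finset H) : Set H)), fun p ↦ by
      ext a
      refine Eq.trans ?_ (hom_comm_apply (s.ι.app ∅) p _)
      refine Eq.trans ?_ (congr_arg _ (cosetAction_single _ A p _ a).symm)
      exact (cosetCocone_ι_single_one s ∅ _ _).symm⟩
  fac s T := cosetRep_hom_ext fun x a ↦ by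
    refine Eq.trans ?_ (cosetCocone_ι_single_one s T x a).symm
    exact congr_arg (fun b ↦ (s.ι.app ∅).hom (Finsupp.single _ b)) (cosetSum_single _ A _ a)
  uniq s m hm := by
    refine Rep.hom_ext (Representation.IntertwiningMap.ext (LinearMap.ext fun a ↦ ?_))
    refine Eq.trans ?_ congr(($(hm ∅)).hom (Finsupp.single
      ((1 : H) : H ⧸ Subgroup.closure ((∅ : Finset H) : Set H)) a))
    exact congr_arg m.hom (cosetSum_single _ A _ a).symm

end Rep

end Cosets

/-! ### Failure of finitariness for H × Q -/

section NotFinitary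

open Limits Rep groupCohomology

namespace groupCohomology

variable {k G G' : Type u} [CommRing k] [Group G] [Group G']

theorem map_add {f : G' →* G} {A : Rep.{u} k G} {B : Rep.{u} k G'} (φ ψ : res f A ⟶ B) (n : ℕ) :
    map f (φ + ψ) n = map f φ n + map f ψ n :=
  HomologicalComplex.homologyMap_add (φ := cochainsMap f φ) (ψ := cochainsMap f ψ) ..

/-- Agreement is required only on the values of one cocycle: the augmentation is a finite sum of
coset evaluations there, though not as a morphism when H/K is infinite. -/
theorem map_π_congr {f : G' →* G} {A : Rep.{u} k G} {B : Rep.{u} k G'} {φ ψ : res f A ⟶ B} {n : ℕ}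
    (z : cocycles A n)
    (h : ∀ x : Fin n → G', φ.hom (iCocycles A n z (f ∘ x)) = ψ.hom (iCocycles A n z (f ∘ x))) :
    map f φ n (π A n z) = map f ψ n (π A n z) := by
  have hc (χ : res f A ⟶ B) :
      iCocycles B n (cocyclesMap f χ n z) = (cochainsMap f χ).f n (iCocycles A n z) :=
    congr($(HomologicalComplex.cyclesMap_i (cochainsMap f χ) n) z)
  have hz : cocyclesMap f φ n z = cocyclesMap f ψ n z := by
    refine (ModuleCat.mono_iff_injective (iCocycles B n)).1 inferInstance ?_
    rw [hc, hc]
    exact funext h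
  exact (π_map_apply f φ n z).trans ((congr_arg _ hz).trans (π_map_apply f ψ n z).symm)

theorem map_sum_apply_eq_zero {f : G' →* G} {A : Rep.{u} k G} {B : Rep.{u} k G'} {n : ℕ}
    {ι : Type*} (φ : ι → (res f A ⟶ B)) (y : groupCohomology A n)
    (h : ∀ c, map f (φ c) n y = 0) (s : Finset ι) : map f (∑ c ∈ s, φ c) n y = 0 := by
  classical
  induction s using Finset.induction with
  | empty =>
    rw [Finset.sum_empty]
    exact congr($(HomologicalComplex.homologyMap_zero (inhomogeneousCochains A)
      (inhomogeneousCochains B) n) y)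
  | insert c s hc ih =>
    rw [Finset.sum_insert hc, map_add]
    change map f (φ c) n y + map f (∑ c ∈ s, φ c) n y = 0
    rw [h, ih, add_zero]

end groupCohomology

variable {k H Q : Type u} [CommRing k] [Group H] [Group Q]

namespace Rep

/-- The `Q`-equivariant evaluation `k[H/K] ⊗ A ⟶ A` at a coset. -/
noncomputable def cosetEval {K : Subgroup H} (c : H ⧸ K) (A : Rep.{u} k Q) :
    res (MonoidHom.inr H Q) (cosetRep K A) ⟶ A :=
  ofHom (ρ := (res (MonoidHom.inr H Q) (cosetRep K A)).ρ) (σ := A.ρ)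
    ⟨Finsupp.lapply c, fun q ↦ LinearMap.ext fun (x : H ⧸ K →₀ A) ↦ by
      simpa using! cosetAction_apply_smul K A (1, q) c x⟩

theorem commute_inr (h : H) (q : Q) : Commute ((h, 1) : H × Q) (MonoidHom.inr H Q q) := by
  simp [Commute, SemiconjBy]

theorem centralizerAct_comp_cosetEval {K : Subgroup H} (h : H) (c : H ⧸ K) (A : Rep.{u} k Q) :
    centralizerAct (MonoidHom.inr H Q) (commute_inr h) (cosetRep K A) ≫ cosetEval (h • c) A =
      cosetEval c A := by
  refine Rep.hom_ext (Representation.IntertwiningMap.ext (LinearMap.ext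
    fun (x : H ⧸ K →₀ A) ↦ ?_))
  refine (cosetAction_apply_smul K A (h, 1) c x).trans ?_
  simp
  rfl

/-- The augmentation `k[H/K] ⊗ A ⟶ A` as a map of representations of `Q`. -/
noncomputable def cosetSumRes (K : Subgroup H) (A : Rep.{u} k Q) :
    res (MonoidHom.inr H Q) (cosetRep K A) ⟶ A :=
  (resFunctor (MonoidHom.inr H Q)).map (cosetSum K A)

theorem cosetSumRes_apply {K : Subgroup H} {A : Rep.{u} k Q} (s : Finset (H ⧸ K))
    (x : H ⧸ K →₀ A) (hx : x.support ⊆ s) :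
    (cosetSumRes K A).hom x = (∑ c ∈ s, cosetEval c A).hom x := by
  refine (Finsupp.sum_of_support_subset x hx (fun _ a ↦ a) fun _ _ ↦ rfl).trans ?_
  rw [Rep.sum_hom]
  exact (Representation.IntertwiningMap.sum_apply (ρ := (res (MonoidHom.inr H Q) (cosetRep K A)).ρ)
    (σ := A.ρ) s (fun c ↦ (cosetEval c A).hom) x).symm

end Rep

namespace groupCohomology

/-- The element (h, 1) moves one coset evaluation to the other, yet acts trivially on classes
restricted to Q. -/
theorem map_cosetEval_smul {K : Subgroup H} (h : H) (c : H ⧸ K) (A : Rep.{u} k Q) (n : ℕ) :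
    map (MonoidHom.inr H Q) (cosetEval (h • c) A) n = map (MonoidHom.inr H Q) (cosetEval c A) n :=
  calc
    _ = map (MonoidHom.inr H Q) (𝟙 (res (MonoidHom.inr H Q) (cosetRep K A))) n ≫
        map (MonoidHom.id Q) (cosetEval (h • c) A) n := by
      rw [← map_comp]
      rfl
    _ = map (MonoidHom.inr H Q) (centralizerAct _ (commute_inr h) (cosetRep K A)) n ≫
        map (MonoidHom.id Q) (cosetEval (h • c) A) n := by
      rw [map_centralizerAct]
    _ = _ := by
      rw [← map_comp, ← centralizerAct_comp_cosetEval h c]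
      rfl

/-- Over a finite group `Q`, a cocycle with values in `k[H/K] ⊗ A` is supported on finitely many
cosets. -/
theorem exists_finset_support_iCocycles_subset [Finite Q] {K : Subgroup H} {A : Rep.{u} k Q}
    {n : ℕ} (z : cocycles (cosetRep K A) n) : ∃ s : Finset (H ⧸ K), ∀ x : Fin n → Q,
      Finsupp.support (M := A) (iCocycles (cosetRep K A) n z (MonoidHom.inr H Q ∘ x)) ⊆ s := by
  classical
  have := Fintype.ofFinite Q
  exact ⟨Finset.univ.biUnion fun x : Fin n → Q ↦
      Finsupp.support (M := A) (iCocycles (cosetRep K A) n z (MonoidHom.inr H Q ∘ x)),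
    fun x ↦ Finset.subset_biUnion_of_mem (fun x : Fin n → Q ↦
      Finsupp.support (M := A) (iCocycles (cosetRep K A) n z (MonoidHom.inr H Q ∘ x)))
      (Finset.mem_univ x)⟩

theorem map_cosetEval_apply_eq_zero [Finite Q] {K : Subgroup H} [Infinite (H ⧸ K)] (c : H ⧸ K)
    (A : Rep.{u} k Q) (n : ℕ) (y : groupCohomology (cosetRep K A) n) :
    map (MonoidHom.inr H Q) (cosetEval c A) n y = 0 := by
  induction y using groupCohomology_induction_on with | h z => ?_
  obtain ⟨s, hs⟩ := exists_finset_support_iCocycles_subset z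
  obtain ⟨c₀, hc₀⟩ := Infinite.exists_notMem_finset s
  obtain ⟨h, rfl⟩ := MulAction.exists_smul_eq H c₀ c
  -- The coset may be replaced by `c₀`, outside the support of the cocycle.
  rw [map_cosetEval_smul]
  refine (map_π_congr (ψ := 0) z fun x ↦ ?_).trans ?_
  · exact Finsupp.notMem_support_iff.1 fun h ↦ hc₀ (hs x h)
  -- The zero morphism is treated as an empty sum.
  · exact map_sum_apply_eq_zero (ι := Empty) (fun c ↦ c.elim) _ (fun c ↦ c.elim) ∅

theorem map_cosetSumRes_apply_eq_zero [Finite Q] {K : Subgroup H} [Infinite (H ⧸ K)]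
    (A : Rep.{u} k Q) (n : ℕ) (y : groupCohomology (cosetRep K A) n) :
    map (MonoidHom.inr H Q) (cosetSumRes K A) n y = 0 := by
  induction y using groupCohomology_induction_on with | h z => ?_
  obtain ⟨s, hs⟩ := exists_finset_support_iCocycles_subset z
  exact (map_π_congr z fun x ↦ cosetSumRes_apply s _ (hs x)).trans
    (map_sum_apply_eq_zero _ _ (fun c ↦ map_cosetEval_apply_eq_zero c A n _) s)

end groupCohomology

/-- Otherwise T and finitely many coset representatives would generate H. -/
theorem infinite_quotient_closure (hH : ¬ Group.FG H) (T : Finset H) :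
    Infinite (H ⧸ Subgroup.closure (T : Set H)) := by
  by_contra hinf
  rw [not_infinite_iff_finite] at hinf
  refine hH ⟨(Subgroup.fg_iff _).2 ⟨T ∪ Set.range
    (Quotient.out : H ⧸ Subgroup.closure (T : Set H) → H), ?_,
    T.finite_toSet.union (Set.finite_range _)⟩⟩
  rw [eq_top_iff]
  intro h _
  have hT := Subgroup.closure_mono (Set.subset_union_left (s := (T : Set H))
    (t := Set.range (Quotient.out : H ⧸ Subgroup.closure (T : Set H) → H)))
  obtain ⟨g, hg⟩ := QuotientGroup.mk_out_eq_mul (Subgroup.closure (T : Set H)) h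
  rw [← mul_inv_eq_iff_eq_mul.2 hg]
  exact mul_mem (Subgroup.subset_closure (.inr ⟨_, rfl⟩)) (inv_mem (hT g.2))

theorem not_cohomologyFinitaryOver_prod [Finite Q] (hQ : ¬ IsUnit (Nat.card Q : k))
    (hH : ¬ Group.FG H) (n : ℕ) : ¬ CohomologyFinitaryOver k (H × Q) n := by
  intro hfin
  have hfin' : PreservesFilteredColimits (functor.{u} k (H × Q) n) := hfin
  obtain ⟨A, x, hx⟩ := exists_ne_zero hQ n
  classical
  obtain ⟨T, y, hy⟩ : ∃ (T : Finset H)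
      (y : groupCohomology (cosetRep (Subgroup.closure (T : Set H)) A) n),
      map (MonoidHom.id _) (cosetSum _ A) n y =
        map (MonoidHom.snd H Q) (𝟙 (res (MonoidHom.snd H Q) A)) n x :=
    lifts_of_preservesFilteredColimits (F := functor.{u} k (H × Q) n) (Finset H) _ _
      (isColimitCosetCocone (H := H) A) _
  have := infinite_quotient_closure hH T
  -- Restricting the inflation to Q returns x, since Q → H × Q → Q is the identity.
  have hx₀ : map (MonoidHom.inr H Q) (𝟙 (res (MonoidHom.inr H Q) (res (MonoidHom.snd H Q) A))) n
      (map (MonoidHom.snd H Q) (𝟙 (res (MonoidHom.snd H Q) A)) n x) = x := by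
    refine congr($(map_comp (MonoidHom.snd H Q) (MonoidHom.inr H Q)
      (𝟙 (res (MonoidHom.snd H Q) A))
      (𝟙 (res (MonoidHom.inr H Q) (res (MonoidHom.snd H Q) A))) n) x).symm.trans ?_
    exact congr($(map_id (B := A) n) x)
  have hy₀ := congr($(map_comp (MonoidHom.id (H × Q)) (MonoidHom.inr H Q)
    (cosetSum (Subgroup.closure (T : Set H)) A)
    (𝟙 (res (MonoidHom.inr H Q) (res (MonoidHom.snd H Q) A))) n) y)
  refine hx (hx₀.symm.trans ((congr_arg _ hy.symm).trans (hy₀.symm.trans ?_)))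
  exact map_cosetSumRes_apply_eq_zero A n y

end NotFinitary

/-! ### The proposition over ℤ -/

theorem proposition4p1 (G : Type u) [Group G] (hG : IsFPInfty G)
    (H : Subgroup G) (hH : ¬ H.FG)
    (Q : Type u) [Group Q] [Finite Q] [Nontrivial Q] :
    CohomologyAlmostEverywhereFinitary (G × Q) ∧
      (∀ n : ℕ, ¬ CohomologyFinitary (H × Q) n) ∧
      ¬ CohomologyAlmostEverywhereFinitary (H × Q) := by
  have hQ : ¬ IsUnit ((Nat.card Q : ℕ) : ULift.{u} ℤ) := by
    intro h
    have h' := h.map (ULift.ringEquiv : ULift.{u} ℤ ≃+* ℤ)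
    rw [map_natCast, Int.isUnit_iff] at h'
    have : 1 < Nat.card Q := Finite.one_lt_card
    lia
  have hn (n : ℕ) : ¬ CohomologyFinitary (H × Q) n :=
    not_cohomologyFinitaryOver_prod hQ (fun h ↦ hH ((Group.fg_iff_subgroup_fg H).1 h)) n
  exact ⟨⟨0, fun n _ ↦ IsFPInftyOver.cohomologyFinitaryOver_prod hG Q n⟩, hn,
    fun ⟨n₀, h⟩ ↦ hn n₀ (h n₀ le_rfl)⟩
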